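/- Let $x_1x_2x_3\dots$ be the Ehrenfeucht–Mycielski (EM) sequence: $x_1x_2x_3=010$ and, for $m\ge 3$, $x_{m+1}$ is the opposite of the bit that follows the last previous occurrence in $x_1\cdots x_m$ of the longest suffix of $x_1\cdots x_m$ that has occurred previously in $x_1\cdots x_m$. For $n\ge 1$ let $R_n$ be the set of all strings in $\{0,1\}^*$ (including the empty string $\lambda$) that occur at least twice, i.e. starting at two different positions, possibly overlapping, as substrings of $x_1\cdots x_n$; here $\lambda$ occurs at each of the positions $1,\dots,n+1$. For $i\ge 1$ let $b^+(i)$ be the longest string starting at position $i$ of the infinite sequence that also occurs in it starting at some position $p$ with $1\le p<i$ (with $b^+(i)=\lambda$ if there is no such nonempty string), and let $L_i$ be the length of $b^+(i)$. Then: 1. For every $i\ge 1$ such a longest string exists, so that $b^+(i)$ and $L_i$ are well defined and finite. 2. For every $n\ge 1$ there is a largest index $x\ge 1$ with $x+L_x-1\le n$, and for this $x$ $$R_n=\{b^+(i): 1\le i\le x\},\qquad |R_n|=x-1 .$$ 3. $|R_n|=n+o(n)$ as $n\to\infty$. -/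

import Mathlib

namespace EM

/-- The suffix of length `l` of the word `w` also occurs in `w` as a block that ends after the
first `p` letters of `w`, where `p < w.length` (an occurrence strictly before the one at the end;
the two occurrences may overlap). -/
def SuffixOccursEarlier (w : List Bool) (l p : ℕ) : Prop :=
  p < w.length ∧ w.drop (w.length - l) <:+ w.take p

instance (w : List Bool) (l p : ℕ) : Decidable (SuffixOccursEarlier w l p) :=
  inferInstanceAs (Decidable (_ ∧ _))

/-- The length of the longest suffix of `w` that has occurred previously in `w`. -/
def longestMatch (w : List Bool) : ℕ :=
  Nat.findGreatest (fun l => ∃ p < w.length, SuffixOccursEarlier w l p) w.length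

/-- The number of letters of `w` up to the end of the last previous occurrence of the longest
suffix of `w` that has occurred previously. -/
def lastMatch (w : List Bool) : ℕ :=
  Nat.findGreatest (fun p => SuffixOccursEarlier w (longestMatch w) p) w.length

/-- The opposite of the letter of `w` that follows the last previous occurrence of the longest
suffix of `w` that has occurred previously. -/
def nextBit (w : List Bool) : Bool :=
  !(w.getD (lastMatch w) false)

/-- The first `n + 3` bits of the Ehrenfeucht–Mycielski sequence
(`false` is the bit `0`, `true` is the bit `1`). -/
def word : ℕ → List Bool
  | 0 => [false, true, false]
  | n + 1 => word n ++ [nextBit (word n)]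

/-- The `i`-th bit `x_i` of the Ehrenfeucht–Mycielski sequence, for `i ≥ 1`
(the value at `i = 0` is never used). -/
def bit (i : ℕ) : Bool :=
  (word i).getD (i - 1) false

/-- The block `x_i x_{i+1} ⋯ x_{i+l-1}` of length `l` that starts at position `i`. -/
def block (i l : ℕ) : List Bool :=
  (List.range l).map fun t => bit (i + t)

/-- The string `w` occurs in `x_1 ⋯ x_n`, starting at position `i`. The empty string starts at each
of the positions `1, …, n + 1`. -/
def OccursAt (n : ℕ) (w : List Bool) (i : ℕ) : Prop :=
  1 ≤ i ∧ i + w.length ≤ n + 1 ∧ block i w.length = w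

/-- The set `R_n` of the strings that occur at least twice as substrings of `x_1 ⋯ x_n`. -/
def R (n : ℕ) : Set (List Bool) :=
  {w | ∃ p q, p < q ∧ OccursAt n w p ∧ OccursAt n w q}

/-- The lengths of the strings which start at position `i` and which occur there for at least the
second time. The length `0` is always included, so that the empty string is available also at
position `1`, before which there is no position. -/
def repeatLengths (i : ℕ) : Set ℕ :=
  {l | l = 0 ∨ ∃ p, 1 ≤ p ∧ p < i ∧ block p l = block i l}

/-- `L_i`, the length of the string `b⁺(i)`. -/
noncomputable def L (i : ℕ) : ℕ :=
  sSup (repeatLengths i)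

/-- `b⁺(i)`, the longest string which starts at position `i` and which occurs there for at least
the second time. -/
noncomputable def bPlus (i : ℕ) : List Bool :=
  block i (L i)

end EM

namespace EM

/-! ### Blocks -/

/-! The recursion forces different bits after the first two occurrences of any word
(`bit_ne_of_unique`), so at its second occurrence a repeated word is the longest repeat. Hence the
repeats at one position are bounded, and `R n` consists of the `bPlus i` that end by n. For i ≥ 2
these are distinct, since a coincidence would give three pairwise different bits (`bPlus_ne_of_lt`).

If n - |R n| exceeded n / K for a large n, a repeat of nearly that length would start at x + 1
inside x_1 ⋯ x_n. Either its subwords at nearby offsets are distinct, which gives more than n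
elements of `R n`, or it contains a long block of small period, which by `le_of_periodic` cannot
occur before a position quadratic in the number of periods. -/

@[simp] lemma length_block (i l : ℕ) : (block i l).length = l := by simp [block]

lemma block_eq_iff {p q l : ℕ} : block p l = block q l ↔ ∀ t < l, bit (p + t) = bit (q + t) := by
  simp [block]

lemma block_eq_mono {p q l k : ℕ} (h : block p l = block q l) (hk : k ≤ l) :
    block p k = block q k :=
  block_eq_iff.2 fun t ht => block_eq_iff.1 h t (ht.trans_le hk)

lemma block_eq_shift {p q l : ℕ} (h : block p l = block q l) (t k : ℕ) (hk : t + k ≤ l) :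
    block (p + t) k = block (q + t) k :=
  block_eq_iff.2 fun s hs => by
    have := block_eq_iff.1 h (t + s) (by omega)
    rwa [← add_assoc, ← add_assoc] at this

lemma block_eq_succ {p q l : ℕ} (h : block p l = block q l) (hb : bit (p + l) = bit (q + l)) :
    block p (l + 1) = block q (l + 1) :=
  block_eq_iff.2 fun t ht => by
    rcases Nat.lt_succ_iff_lt_or_eq.1 ht with h' | rfl
    · exact block_eq_iff.1 h t h'
    · exact hb

lemma length_eq_of_block_eq {p q l k : ℕ} (h : block p l = block q k) : l = k := by
  simpa using congrArg List.length h

lemma drop_block (i l k : ℕ) : (block i l).drop k = block (i + k) (l - k) := by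
  apply List.ext_getElem
  · simp
  · intro t h₁ h₂
    simp [block, add_assoc]

lemma take_block (i l k : ℕ) (hk : k ≤ l) : (block i l).take k = block i k := by
  apply List.ext_getElem
  · simpa using hk
  · intro t h₁ h₂
    simp [block]

lemma getD_block (i l t : ℕ) (ht : t < l) : (block i l).getD t false = bit (i + t) := by
  simp [block, List.getD, ht]

/-! ### The defining recursion in terms of bits -/

lemma length_word (n : ℕ) : (word n).length = n + 3 := by
  induction n with
  | zero => rfl
  | succ n ih => simp [word, ih]

lemma getElem?_word_succ (n t : ℕ) (ht : t < n + 3) : (word (n + 1))[t]? = (word n)[t]? := by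
  rw [word, List.getElem?_append_left (by rwa [length_word])]

lemma getElem?_word_add (n k t : ℕ) (ht : t < n + 3) : (word (n + k))[t]? = (word n)[t]? := by
  induction k with
  | zero => rfl
  | succ k ih => rw [← add_assoc, getElem?_word_succ _ _ (by omega), ih]

lemma getElem?_word (n t : ℕ) (ht : t < n + 3) : (word n)[t]? = some (bit (t + 1)) := by
  have h : (word n)[t]? = (word (t + 1))[t]? := by
    rcases le_total n (t + 1) with h | h <;> obtain ⟨k, hk⟩ := Nat.exists_eq_add_of_le h
    · rw [hk, getElem?_word_add _ _ _ ht]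
    · rw [hk, getElem?_word_add _ _ _ (by omega)]
  have hl : t < (word (t + 1)).length := by rw [length_word]; omega
  rw [h, bit, Nat.add_sub_cancel, List.getD, List.getElem?_eq_getElem hl, Option.getD_some]

lemma word_eq_block (n : ℕ) : word n = block 1 (n + 3) := by
  apply List.ext_getElem?
  intro t
  rcases lt_or_ge t (n + 3) with h | h
  · rw [getElem?_word n t h]
    simp [block, h, add_comm]
  · rw [List.getElem?_eq_none (by rwa [length_word]), List.getElem?_eq_none (by simpa using h)]

lemma bit_add_four (n : ℕ) : bit (n + 4) = nextBit (word n) := by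
  have h := getElem?_word (n + 1) (n + 3) (by omega)
  rw [word, List.getElem?_append_right (by rw [length_word]), length_word] at h
  simpa using h.symm

lemma suffixOccursEarlier_iff {m l p : ℕ} (hl : l ≤ m) :
    SuffixOccursEarlier (block 1 m) l p ↔
      p < m ∧ l ≤ p ∧ block (m - l + 1) l = block (p - l + 1) l := by
  rw [SuffixOccursEarlier, length_block]
  refine and_congr_right fun hp => ?_
  rw [drop_block, take_block _ _ _ hp.le, Nat.sub_sub_self hl, List.suffix_iff_eq_drop,
    length_block, length_block, drop_block, add_comm 1, add_comm 1]
  constructor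
  · intro h
    have hlp : l ≤ p := by
      have := length_eq_of_block_eq h
      omega
    exact ⟨hlp, by rwa [Nat.sub_sub_self hlp] at h⟩
  · rintro ⟨hlp, h⟩
    rwa [Nat.sub_sub_self hlp]

/-- The first two occurrences of a word are followed by different bits. -/
lemma bit_ne_of_unique {p q l : ℕ} (hp : 1 ≤ p) (hpq : p < q) (h : block p l = block q l)
    (huniq : ∀ p', 1 ≤ p' → p' < q → block p' l = block q l → p' = p) :
    bit (p + l) ≠ bit (q + l) := by
  have h12 : bit 1 ≠ bit 2 := by decide
  rcases lt_or_ge (q + l) 4 with hs | hs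
  · rcases Nat.eq_zero_or_pos l with rfl | hl
    · have : p = 1 := (huniq 1 le_rfl (by omega) rfl).symm
      subst this
      have : q = 2 := by
        by_contra hq
        have := huniq 2 (by norm_num) (by omega) rfl
        omega
      subst this
      exact h12
    · have h1 : p = 1 := by omega
      have h2 : q = 2 := by omega
      subst h1 h2
      exact absurd (block_eq_iff.1 h 0 hl) h12
  · obtain ⟨n, hn⟩ := Nat.exists_eq_add_of_le' hs
    have hw := word_eq_block n
    have hlen := length_word n
    have hpos : ∃ P < (word n).length, SuffixOccursEarlier (word n) l P := by
      refine ⟨p + l - 1, by omega, ?_⟩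
      rw [hw, suffixOccursEarlier_iff (by omega)]
      refine ⟨by omega, by omega, ?_⟩
      rw [show n + 3 - l + 1 = q by omega, show p + l - 1 - l + 1 = p by omega, h]
    have hle : l ≤ longestMatch (word n) :=
      Nat.le_findGreatest (P := fun l => ∃ p < (word n).length, SuffixOccursEarlier (word n) l p)
        (by omega) hpos
    have hmax : longestMatch (word n) ≤ n + 3 := (Nat.findGreatest_le _).trans hlen.le
    obtain ⟨P, hP, hPS⟩ : ∃ P < (word n).length,
        SuffixOccursEarlier (word n) (longestMatch (word n)) P :=
      Nat.findGreatest_spec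
        (P := fun l => ∃ p < (word n).length, SuffixOccursEarlier (word n) l p)
        (m := l) (by omega) hpos
    have hlast : SuffixOccursEarlier (word n) (longestMatch (word n)) (lastMatch (word n)) :=
      Nat.findGreatest_spec (P := fun p => SuffixOccursEarlier (word n) (longestMatch (word n)) p)
        (m := P) hP.le hPS
    rw [hn, bit_add_four, nextBit]
    generalize lastMatch (word n) = Q at hlast
    generalize longestMatch (word n) = S at hlast hle hmax
    rw [hw, suffixOccursEarlier_iff hmax] at hlast
    obtain ⟨hQ, hSQ, heq⟩ := hlast
    -- The longest match ends in an earlier copy of the length-`l` word; by uniqueness it starts at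
    -- `p`, so the rule negates `bit (p + l)`.
    have heq' := block_eq_shift heq (S - l) l (by omega)
    rw [show n + 3 - S + 1 + (S - l) = q by omega,
      show Q - S + 1 + (S - l) = Q - l + 1 by omega] at heq'
    have := huniq (Q - l + 1) (by omega) (by omega) heq'.symm
    rw [hw, getD_block _ _ _ hQ, show 1 + Q = p + l by omega]
    simp

/-! ### Longest repeats -/

/-- A longer repeat would have to start at `p` as well, where the next bit disagrees. -/
lemma isGreatest_of_unique {p q l : ℕ} (hp : 1 ≤ p) (hpq : p < q) (h : block p l = block q l)
    (huniq : ∀ p', 1 ≤ p' → p' < q → block p' l = block q l → p' = p) :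
    IsGreatest (repeatLengths q) l := by
  refine ⟨Or.inr ⟨p, hp, hpq, h⟩, ?_⟩
  rintro k (rfl | ⟨p', hp', hpq', h'⟩)
  · exact Nat.zero_le _
  · by_contra! hk
    have := huniq p' hp' hpq' (block_eq_mono h' hk.le)
    subst this
    exact bit_ne_of_unique hp hpq h huniq (block_eq_iff.1 h' l hk)

/-- The second occurrence of a repeated word is a position at which this word is the longest
repeat. -/
lemma exists_second_occurrence {p i l : ℕ} (hp : 1 ≤ p) (hpi : p < i)
    (h : block p l = block i l) :
    ∃ p' q, 1 ≤ p' ∧ p' < q ∧ q ≤ i ∧ block p' l = block i l ∧ block q l = block i l ∧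
      bit (p' + l) ≠ bit (q + l) ∧ IsGreatest (repeatLengths q) l := by
  classical
  have hex : ∃ q, block q l = block i l ∧ ∃ p, 1 ≤ p ∧ p < q ∧ block p l = block i l :=
    ⟨i, rfl, p, hp, hpi, h⟩
  obtain ⟨hq, p', hp', hpq', h'⟩ := Nat.find_spec hex
  have hmin := fun {m} => Nat.find_min (m := m) hex
  have hle : Nat.find hex ≤ i := Nat.find_min' hex ⟨rfl, p, hp, hpi, h⟩
  generalize Nat.find hex = q at *
  have huniq : ∀ r, 1 ≤ r → r < q → block r l = block q l → r = p' := by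
    intro r hr hrq hrb
    rw [hq] at hrb
    rcases lt_trichotomy r p' with hlt | heq | hlt
    · exact absurd ⟨h', r, hr, hlt, hrb⟩ (hmin hpq')
    · exact heq
    · exact absurd ⟨hrb, p', hp', hlt, h'⟩ (hmin hrq)
  have hpq : block p' l = block q l := h'.trans hq.symm
  exact ⟨p', q, hp', hpq', hle, h', hq, bit_ne_of_unique hp' hpq' hpq huniq,
    isGreatest_of_unique hp' hpq' hpq huniq⟩

/-- Pigeonhole: otherwise every length would be the longest repeat length of some position up to
`i`. -/
lemma bddAbove_repeatLengths (i : ℕ) : BddAbove (repeatLengths i) := by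
  by_contra hb
  have hall : ∀ l, ∃ q, q ≤ i ∧ IsGreatest (repeatLengths q) l := by
    intro l
    obtain ⟨k, hk, hlk⟩ := not_bddAbove_iff.1 hb l
    rcases hk with rfl | ⟨p, hp, hpi, h⟩
    · omega
    · obtain ⟨_, q, _, _, hq, _, _, _, hg⟩ :=
        exists_second_occurrence hp hpi (block_eq_mono h hlk.le)
      exact ⟨q, hq, hg⟩
  choose q hq hg using hall
  have hinj : Function.Injective fun l => (⟨q l, Nat.lt_succ_of_le (hq l)⟩ : Fin (i + 1)) := by
    intro l k hlk
    have hlk' : q l = q k := congrArg Fin.val hlk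
    have h := hg l
    rw [hlk'] at h
    exact h.unique (hg k)
  exact not_injective_infinite_finite _ hinj

lemma isGreatest_L (i : ℕ) : IsGreatest (repeatLengths i) (L i) :=
  ⟨Nat.sSup_mem ⟨0, Or.inl rfl⟩ (bddAbove_repeatLengths i),
    fun _ hl => le_csSup (bddAbove_repeatLengths i) hl⟩

lemma L_one : L 1 = 0 := by
  rcases (isGreatest_L 1).1 with h | ⟨p, hp, hp1, _⟩
  · exact h
  · omega

lemma L_two : L 2 = 0 := by
  rcases (isGreatest_L 2).1 with h | ⟨p, hp, hp2, h⟩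
  · exact h
  · obtain rfl : p = 1 := by omega
    by_contra h0
    exact absurd (block_eq_iff.1 h 0 (Nat.pos_of_ne_zero h0)) (by decide)

lemma exists_block_eq_bPlus {i : ℕ} (hi : 2 ≤ i) :
    ∃ p, 1 ≤ p ∧ p < i ∧ block p (L i) = bPlus i := by
  rcases (isGreatest_L i).1 with h | h
  · exact ⟨1, le_rfl, hi, by simp [bPlus, h, block]⟩
  · exact h

/-- Dropping the first letter of a repeat leaves a repeat. -/
lemma L_le_L_succ_add_one {i : ℕ} : L i ≤ L (i + 1) + 1 := by
  rcases (isGreatest_L i).1 with h | ⟨p, hp, hpi, h⟩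
  · omega
  · have : L i - 1 ≤ L (i + 1) := by
      rcases Nat.eq_zero_or_pos (L i) with h0 | h0
      · omega
      · exact (isGreatest_L (i + 1)).2 (Or.inr ⟨p + 1, by omega, by omega,
          block_eq_shift h 1 _ (by omega)⟩)
    omega

lemma monotone_add_L : Monotone fun i => i + L i :=
  monotone_nat_of_le_succ fun i => by
    have := L_le_L_succ_add_one (i := i)
    show i + L i ≤ i + 1 + L (i + 1)
    omega

/-- With an earlier copy at `p`, maximality at `i` and `j` would make the bits after the copies at
`p`, `i`, `j` pairwise different. -/
lemma bPlus_ne_of_lt {i j : ℕ} (hi : 2 ≤ i) (hij : i < j) : bPlus i ≠ bPlus j := by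
  intro h
  have hL : L i = L j := length_eq_of_block_eq h
  obtain ⟨p, hp, hpi, hpb⟩ := exists_block_eq_bPlus hi
  have hij' : block i (L j) = block j (L j) := by
    have h' := h
    rwa [bPlus, bPlus, hL] at h'
  have hpj : block p (L j) = block j (L j) := by rw [← hL, hpb, h, bPlus, hL]
  have hne : bit (p + L i) ≠ bit (i + L i) := fun hb => by
    have := (isGreatest_L i).2 (Or.inr ⟨p, hp, hpi, block_eq_succ hpb hb⟩)
    omega
  have hne_p : bit (p + L j) ≠ bit (j + L j) := fun hb => by
    have := (isGreatest_L j).2 (Or.inr ⟨p, hp, by omega, block_eq_succ hpj hb⟩)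
    omega
  have hne_i : bit (i + L j) ≠ bit (j + L j) := fun hb => by
    have := (isGreatest_L j).2 (Or.inr ⟨i, by omega, hij, block_eq_succ hij' hb⟩)
    omega
  rw [hL] at hne
  revert hne hne_p hne_i
  generalize bit (p + L j) = a
  generalize bit (i + L j) = b
  generalize bit (j + L j) = c
  revert a b c
  decide

lemma injOn_bPlus : Set.InjOn bPlus (Set.Ici 2) := by
  intro i hi j hj h
  rcases lt_trichotomy i j with hlt | heq | hlt
  · exact absurd h (bPlus_ne_of_lt hi hlt)
  · exact heq
  · exact absurd h.symm (bPlus_ne_of_lt hj hlt)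

/-! ### The set of repeated words -/

lemma mem_R_of_block_eq {n p i l : ℕ} (hp : 1 ≤ p) (hpi : p < i) (h : block p l = block i l)
    (hn : i + l ≤ n + 1) : block i l ∈ R n :=
  ⟨p, i, hpi, ⟨hp, by rw [length_block]; omega, by rw [length_block, h]⟩,
    ⟨by omega, by rwa [length_block], by rw [length_block]⟩⟩

lemma exists_isGreatest {n : ℕ} (hn : 1 ≤ n) :
    ∃ x, 2 ≤ x ∧ IsGreatest {i : ℕ | 1 ≤ i ∧ i + L i - 1 ≤ n} x := by
  have hbdd : BddAbove {i : ℕ | 1 ≤ i ∧ i + L i - 1 ≤ n} :=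
    ⟨n + 1, fun i hi => by have := hi.2; omega⟩
  have h2 : 2 ∈ {i : ℕ | 1 ≤ i ∧ i + L i - 1 ≤ n} :=
    ⟨by norm_num, by rw [L_two]; omega⟩
  exact ⟨_, le_csSup hbdd h2, Nat.sSup_mem ⟨2, h2⟩ hbdd, fun _ hi => le_csSup hbdd hi⟩

lemma R_eq_image {n x : ℕ} (hx : IsGreatest {i : ℕ | 1 ≤ i ∧ i + L i - 1 ≤ n} x) :
    R n = bPlus '' Set.Icc 2 x := by
  ext w
  constructor
  · rintro ⟨p, i, hpi, ⟨hp, _, hpw⟩, ⟨hi, hin, hiw⟩⟩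
    obtain ⟨_, q, hp', hpq, hqi, _, hq, _, hg⟩ :=
      exists_second_occurrence hp hpi (hpw.trans hiw.symm)
    have hL : L q = w.length := (isGreatest_L q).unique hg
    refine ⟨q, ⟨by omega, hx.2 ⟨by omega, by omega⟩⟩, ?_⟩
    rw [bPlus, hL, hq, hiw]
  · rintro ⟨i, ⟨hi, hix⟩, rfl⟩
    obtain ⟨p, hp, hpi, h⟩ := exists_block_eq_bPlus hi
    have hmono : i + L i ≤ x + L x := monotone_add_L hix
    have := hx.1.2
    exact mem_R_of_block_eq hp hpi h (by omega)

lemma finite_R {n x : ℕ} (hx : IsGreatest {i : ℕ | 1 ≤ i ∧ i + L i - 1 ≤ n} x) :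
    (R n).Finite := by
  rw [R_eq_image hx]
  exact (Set.finite_Icc 2 x).image _

lemma ncard_R {n x : ℕ} (h2 : 2 ≤ x) (hx : IsGreatest {i : ℕ | 1 ≤ i ∧ i + L i - 1 ≤ n} x) :
    (R n).ncard + 1 = x := by
  rw [R_eq_image hx, (injOn_bPlus.mono fun i hi => hi.1).ncard_image,
    ← Finset.coe_Icc, Set.ncard_coe_finset, Nat.card_Icc]
  omega

/-- Index 1 adds nothing, because `bPlus 1` and `bPlus 2` are both empty; hence the cardinality x -
1. -/
lemma R_eq_setOf {n x : ℕ} (h2 : 2 ≤ x)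
    (hx : IsGreatest {i : ℕ | 1 ≤ i ∧ i + L i - 1 ≤ n} x) :
    R n = {w : List Bool | ∃ i : ℕ, 1 ≤ i ∧ i ≤ x ∧ w = bPlus i} := by
  rw [R_eq_image hx]
  ext w
  constructor
  · rintro ⟨i, ⟨hi, hix⟩, rfl⟩
    exact ⟨i, by omega, hix, rfl⟩
  · rintro ⟨i, hi, hix, rfl⟩
    rcases Nat.lt_or_ge i 2 with h | h
    · obtain rfl : i = 1 := by omega
      exact ⟨2, ⟨le_rfl, h2⟩, by simp [bPlus, L_one, L_two, block]⟩
    · exact ⟨i, ⟨h, hix⟩, rfl⟩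

/-! ### Periodic blocks occur late -/

/-- If the block of length `k + d` at `z` has period `d`, then its prefix of length
`d + j * (d + 1)` does not occur before position `j * (j - 1) / 2`. -/
lemma le_of_periodic {z k d : ℕ} (hd : 1 ≤ d) (hper : block z k = block (z + d) k) (j : ℕ) :
    ∀ i, 1 ≤ i → j * (d + 1) ≤ k → block i (d + j * (d + 1)) = block z (d + j * (d + 1)) →
      j * (j - 1) ≤ 2 * i := by
  classical
  induction j with
  | zero => intro i _ _ _; simp
  | succ j ih =>
    intro i hi hk hb
    set h := d + j * (d + 1) with hh
    have hjd : j + d ≤ h := by nlinarith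
    have hh' : d + (j + 1) * (d + 1) = h + d + 1 := by rw [hh]; ring
    rw [hh'] at hb
    have hk' : h + 1 ≤ k := by
      have : (j + 1) * (d + 1) = h + 1 := by rw [hh]; ring
      omega
    have hper' : ∀ t, d ≤ t → t < h + d + 1 → bit (z + t) = bit (z + (t - d)) := by
      intro t h1 h2
      have := block_eq_iff.1 hper (t - d) (by omega)
      rw [this]
      congr 1
      omega
    have hex : ∃ f, 1 ≤ f ∧ block f h = block z h := ⟨i, hi, block_eq_mono hb (by omega)⟩
    obtain ⟨hf, hfb⟩ := Nat.find_spec hex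
    have hmin : ∀ m, 1 ≤ m → block m h = block z h → Nat.find hex ≤ m :=
      fun m h1 h2 => Nat.find_min' hex ⟨h1, h2⟩
    generalize Nat.find hex = f at *
    have hfi : f ≤ i := hmin i hi (block_eq_mono hb (by omega))
    have hjf : j * (j - 1) ≤ 2 * f := ih f hf (by nlinarith) hfb
    -- Closer copies at `f` and `i` would overlap enough to extend the periodic run from `f` to
    -- length `h + d + 1`. The first two occurrences of the length-`h` word would then start in [f,
    -- f + d] and be followed by the same bit.
    have hgap : f + j ≤ i := by
      by_contra! hlt
      have hrun : ∀ t, t < h + d + 1 → bit (f + t) = bit (z + t) := by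
        intro t
        induction t using Nat.strong_induction_on with
        | _ t iht =>
          intro ht
          rcases Nat.lt_or_ge t h with hth | hth
          · exact block_eq_iff.1 hfb t hth
          · have e1 := block_eq_iff.1 hb (t - (i - f)) (by omega)
            have e2 := hper' (t - (i - f)) (by omega) (by omega)
            have e3 := block_eq_iff.1 hb (t - (i - f) - d) (by omega)
            have e4 := iht (t - d) (by omega) (by omega)
            have e5 := hper' t (by omega) ht
            rw [show i + (t - (i - f)) = f + t by omega] at e1
            rw [show i + (t - (i - f) - d) = f + (t - d) by omega] at e3
            rw [e1, e2, ← e3, e4, ← e5]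
      have hshift : block f h = block (f + d) h := block_eq_iff.2 fun t ht => by
        rw [add_assoc, hrun t (by omega), hrun (d + t) (by omega), hper' (d + t) (by omega)
          (by omega), Nat.add_sub_cancel_left]
      obtain ⟨p, q, hp, hpq, hq, hpb, hqb, hne, _⟩ :=
        exists_second_occurrence hf (by omega : f < f + d) hshift
      rw [← hshift, hfb] at hpb hqb
      have hfp := hmin p hp hpb
      have hback : ∀ r, f ≤ r → r ≤ f + d → block r h = block z h →
          bit (r + h) = bit (z + (h - d)) := by
        intro r h1 h2 hr
        rw [show r + h = f + (r - f + h) by omega, hrun _ (by omega),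
          hper' _ (by omega) (by omega), ← hrun _ (by omega),
          ← block_eq_iff.1 hr (h - d) (by omega)]
        congr 1
        omega
      exact hne ((hback p hfp (by omega) hpb).trans (hback q (by omega) hq hqb).symm)
    have : (j + 1) * (j + 1 - 1) = j * (j - 1) + 2 * j := by
      cases j with
      | zero => rfl
      | succ j => simp only [Nat.add_sub_cancel]; ring
    omega

/-! ### Counting repeated words: the asymptotic estimate -/

/-- A long repeat forces many distinct repeated words, or a long block with a small period. -/
lemma repeat_bound {n i p l D : ℕ} (hp : 1 ≤ p) (hpi : p < i) (h : block p l = block i l)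
    (hn : i + l ≤ n + 1) (hD : 2 * D ≤ l) (hfin : (R n).Finite) :
    (D + 1) * (l / 4) ≤ (R n).ncard ∨
      (l / 4 / (D + 1)) * (l / 4 / (D + 1) - 1) ≤ 2 * (n + 1) := by
  set a := l / 4 with ha
  by_cases hrep : ∃ k t t', a ≤ k ∧ t < t' ∧ t' ≤ D ∧ block (i + t) k = block (i + t') k
  · right
    obtain ⟨k, t, t', hak, htt, htD, hb⟩ := hrep
    obtain ⟨d, rfl⟩ := Nat.exists_eq_add_of_le htt.le
    rw [← add_assoc] at hb
    have hle : a / (D + 1) * (d + 1) ≤ k :=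
      calc a / (D + 1) * (d + 1) ≤ a / (D + 1) * (D + 1) := Nat.mul_le_mul_left _ (by omega)
        _ ≤ a := Nat.div_mul_le_self _ _
        _ ≤ k := hak
    have := le_of_periodic (by omega) hb (a / (D + 1)) (i + t) (by omega) hle rfl
    omega
  · left
    have hinj : Set.InjOn (fun x : ℕ × ℕ => block (i + x.1) x.2)
        ↑(Finset.range (D + 1) ×ˢ Finset.Ico a (2 * a)) := by
      rintro ⟨t, k⟩ hx ⟨t', k'⟩ hx' hb
      simp only [Finset.coe_product, Set.mem_prod, Finset.mem_coe, Finset.mem_range,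
        Finset.mem_Ico] at hx hx'
      obtain rfl : k = k' := length_eq_of_block_eq hb
      rcases lt_trichotomy t t' with hlt | heq | hlt
      · exact absurd ⟨k, t, t', hx.2.1, hlt, by omega, hb⟩ hrep
      · rw [heq]
      · exact absurd ⟨k, t', t, hx.2.1, hlt, by omega, hb.symm⟩ hrep
    have hsub : (fun x : ℕ × ℕ => block (i + x.1) x.2) ''
        ↑(Finset.range (D + 1) ×ˢ Finset.Ico a (2 * a)) ⊆ R n := by
      rintro _ ⟨⟨t, k⟩, hx, rfl⟩
      simp only [Finset.coe_product, Set.mem_prod, Finset.mem_coe, Finset.mem_range,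
        Finset.mem_Ico] at hx
      exact mem_R_of_block_eq (by omega) (by omega : p + t < i + t)
        (block_eq_shift h t k (by omega)) (by omega)
    have := Set.ncard_le_ncard hsub hfin
    rw [hinj.ncard_image, Set.ncard_coe_finset, Finset.card_product, Finset.card_range,
      Nat.card_Ico] at this
    rwa [show 2 * a - a = a by omega] at this

/-- The number of repeated words in `x_1 ⋯ x_n` differs from `n` by at most `n / K`, for large
`n`. -/
lemma exists_forall_mul_sub_le {K : ℕ} (hK : 1 ≤ K) :
    ∃ n₀, ∀ n, n₀ ≤ n → (R n).ncard ≤ n ∧ K * (n - (R n).ncard) ≤ n := by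
  refine ⟨K * (4 * (8 * K + 1) * (8 * K * (8 * K + 1) + 20) + 16 * K + 7) + 1,
    fun n hn => ?_⟩
  have hn1 : 1 ≤ n := by omega
  obtain ⟨x, h2, hx⟩ := exists_isGreatest hn1
  have hcard := ncard_R h2 hx
  have hxn : x ≤ n + 1 := by have := hx.1.2; omega
  refine ⟨by omega, ?_⟩
  by_contra! hlt
  obtain ⟨l, hl⟩ : ∃ l, n + 1 = x + l := Nat.exists_eq_add_of_le hxn
  have hnl : n - (R n).ncard = l := by omega
  rw [hnl] at hlt
  obtain ⟨m, rfl⟩ : ∃ m, l = m + 1 :=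
    Nat.exists_eq_succ_of_ne_zero fun h0 => by simp [h0] at hlt
  obtain ⟨p, hp, hpx, hb⟩ := exists_block_eq_bPlus (i := x + 1) (by omega)
  -- Otherwise `x + 1` would also be admissible, against the maximality of `x`.
  have hL : m ≤ L (x + 1) := by
    by_contra! hLm
    have := hx.2 (⟨by omega, by omega⟩ : 1 ≤ x + 1 ∧ x + 1 + L (x + 1) - 1 ≤ n)
    omega
  have hm : 4 * (8 * K + 1) * (8 * K * (8 * K + 1) + 20) + 16 * K + 7 < m + 1 :=
    lt_of_mul_lt_mul_left (by omega) (Nat.zero_le K)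
  set C := 8 * K * (8 * K + 1) with hC
  -- With D = 8K, the first alternative gives (8K + 1)(m / 4) ≤ n, while n < K(m + 1) ≤ 8K(m / 4).
  have hD : 2 * (8 * K) ≤ m := by omega
  have hm4 : m + 1 ≤ 4 * (m / 4 + 1) := by omega
  have hKm := Nat.mul_le_mul_left K hm4
  rcases repeat_bound hp hpx (block_eq_mono hb hL) (by omega : x + 1 + m ≤ n + 1) hD
    (finite_R hx) with h | h
  · have ha : 1 ≤ m / 4 := by omega
    nlinarith
  · set a := m / 4
    have ha : a + 1 ≤ (8 * K + 1) * (a / (8 * K + 1) + 1) :=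
      Nat.lt_mul_div_succ a (by omega)
    generalize a / (8 * K + 1) = J at h ha
    have hn2 : n + 1 ≤ K * (4 * ((8 * K + 1) * (J + 1))) :=
      calc n + 1 ≤ K * (m + 1) := hlt
        _ ≤ K * (4 * (a + 1)) := hKm
        _ ≤ _ := by gcongr
    have hJ : J * (J - 1) ≤ C * (J + 1) := by
      calc J * (J - 1) ≤ 2 * (n + 1) := h
        _ ≤ 2 * (K * (4 * ((8 * K + 1) * (J + 1)))) := by gcongr
        _ = C * (J + 1) := by rw [hC]; ring
    -- The quadratic bound caps `J`, hence `m`, independently of n.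
    have hJC : J ≤ C + 3 := by
      by_contra! hlt'
      obtain ⟨r, rfl⟩ : ∃ r, J = C + 4 + r := Nat.exists_eq_add_of_le (by omega)
      rw [show C + 4 + r - 1 = C + 3 + r by omega] at hJ
      nlinarith [Nat.zero_le (C * r), Nat.zero_le (r * r)]
    have hbig : 4 * (a + 1) ≤ 4 * (8 * K + 1) * (C + 20) :=
      calc 4 * (a + 1) ≤ 4 * ((8 * K + 1) * (J + 1)) := by gcongr
        _ = 4 * (8 * K + 1) * (J + 1) := by ring
        _ ≤ _ := Nat.mul_le_mul_left _ (by omega)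
    omega

end EM

theorem proposition3 :
    (∀ i : ℕ, 1 ≤ i → IsGreatest (EM.repeatLengths i) (EM.L i)) ∧
    (∀ n : ℕ, 1 ≤ n → ∃ x : ℕ,
      IsGreatest {i : ℕ | 1 ≤ i ∧ i + EM.L i - 1 ≤ n} x ∧
      EM.R n = {w : List Bool | ∃ i : ℕ, 1 ≤ i ∧ i ≤ x ∧ w = EM.bPlus i} ∧
      (EM.R n).Finite ∧ (EM.R n).ncard + 1 = x) ∧
    Asymptotics.IsLittleO Filter.atTop
      (fun n : ℕ => ((EM.R n).ncard : ℝ) - (n : ℝ)) (fun n : ℕ => (n : ℝ)) := by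
  refine ⟨fun i _ => EM.isGreatest_L i, fun n hn => ?_, ?_⟩
  · obtain ⟨x, h2, hx⟩ := EM.exists_isGreatest hn
    exact ⟨x, hx, EM.R_eq_setOf h2 hx, EM.finite_R hx, EM.ncard_R h2 hx⟩
  · rw [Asymptotics.isLittleO_iff]
    intro c hc
    obtain ⟨K, hK⟩ := exists_nat_gt (1 / c)
    have hK0 : (0 : ℝ) < K := (by positivity : (0 : ℝ) < 1 / c).trans hK
    obtain ⟨n₀, h₀⟩ := EM.exists_forall_mul_sub_le (K := K) (by exact_mod_cast hK0)
    filter_upwards [Filter.eventually_ge_atTop n₀] with n hn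
    obtain ⟨hle, hmul⟩ := h₀ n hn
    have hmul' : (K : ℝ) * ((n : ℝ) - (EM.R n).ncard) ≤ n := by
      rw [← Nat.cast_sub hle]
      exact_mod_cast hmul
    have hle' : ((EM.R n).ncard : ℝ) ≤ n := by exact_mod_cast hle
    rw [Real.norm_eq_abs, Real.norm_eq_abs, Nat.abs_cast, abs_sub_comm,
      abs_of_nonneg (sub_nonneg.2 hle')]
    have hcK : 1 < K * c := by rwa [div_lt_iff₀ hc] at hK
    nlinarith [mul_nonneg hc.le (sub_nonneg.2 hmul'),
      mul_nonneg (sub_nonneg.2 hcK.le) (sub_nonneg.2 hle')]
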